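/- Consider a discrete-time system $x_{t+1}=f_t(x_t,u_t,w_t)$, $t=0,\dots,H-1$, with $x_t\in\mathbb R^{n_x}$, $u_t\in\mathbb R^{n_u}$, $w_t\in\mathbb R^{n_w}$. For a state-feedback policy $\pi$ (with $u_t=\pi_t(x_0,\dots,x_t)$) and an uncertainty instance $z=(x_0,w)$, $w=(w_0,\dots,w_{H-1})$, let $J(\pi,z)=\sum_{t=0}^{H}\ell_t\big(x_t,\pi_t(x_0,\dots,x_t)\big)$ be the cost along the closed-loop trajectory. Let $\pi^\theta$, $\theta\in\mathbb R^{n_\theta}$, be a parameterized family of policies and $\bar J\in\mathbb R$ a threshold. Let $D=(z_1,\dots,z_N)$ be a list of i.i.d. draws with (arbitrary, unknown) distribution $\mathbb P_z$, and let $N_i\le N$. Let $L$ be a synthesis algorithm, that is, a map from finite lists $T$ of data points to parameters $L(T)=\theta(T)$, for example a minimizer over $\theta$ of the empirical cost $\frac1{|T|}\sum_{z\in T}J(\pi^\theta,z)$; no property of $L$ besides measurability is needed. The meta-algorithm Pick-to-Learn (P2L) proceeds as follows. The first $N_i$ points of $D$ are used to compute (in an arbitrary measurable way) an initial parameter $\theta_0$;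 let $D'$ be the list of the remaining $N-N_i$ points. Start with $T=\emptyset$, $\theta=\theta_0$. While some $z\in D'\setminus T$ has $J(\pi^\theta,z)>\bar J$, append to $T$ the point of $D'\setminus T$ with the highest cost $J(\pi^\theta,\cdot)$ (ties are broken according to a pre-specified total order on the data points, which may depend on $T$), and set $\theta=\theta(T)$. At termination, return $T$ and the policy $\pi(D)=\pi^\theta$ (so $\theta=\theta(T)$, or $\theta=\theta_0$ if $T=\emptyset$). All list operations count repetitions. For $\delta\in(0,1)$, an integer $n\ge 0$ and $k=0,\dots,n-1$, let $\bar\varepsilon(k,\delta,n)$ be the unique solution $\varepsilon\in[k/n,1]$ of $$\frac{\delta}{n}\sum_{m=k}^{n-1}\frac{\binom mk}{\binom nk}(1-\varepsilon)^{-(n-m)}=1,$$ and let $\bar\varepsilon(n,\delta,n)=1$. Then, for every $\delta\in(0,1)$, with probability at least $1-\delta$ with respect to the draw of $D$, $$\mathbb P_z\big[z:\ J(\pi(D),z)>\bar J\big]\ \le\ \bar\varepsilon(|T|,\delta,N-N_i).$$ -/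

import Mathlib

namespace P2L

section Bound

/-- `Ψ_{k,δ}(ε) = (δ / N) ∑_{m=k}^{N-1} (m choose k) / (N choose k) (1 - ε)^{-(N-m)}`. -/
noncomputable def Psi (N k : ℕ) (δ ε : ℝ) : ℝ :=
  δ / N * ∑ m ∈ Finset.Ico k N,
    ((m.choose k : ℝ) / (N.choose k : ℝ)) * ((1 - ε) ^ (N - m))⁻¹

/-- `ε̄(k, δ, N)`: for `k < N` the solution of `Ψ_{k,δ}(ε) = 1` in `[k/N, 1]` (it exists and is
unique for `0 < δ < 1`, see `existsUnique_psi_eq_one` and `epsBar_spec`); for `k = N` the value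
`1`. -/
noncomputable def epsBar (k : ℕ) (δ : ℝ) (N : ℕ) : ℝ :=
  if k < N then sInf {ε : ℝ | ε ∈ Set.Icc ((k : ℝ) / N) 1 ∧ Psi N k δ ε = 1} else 1

theorem psi_strictMonoOn {N k : ℕ} {δ : ℝ} (hk : k < N) (hδ : 0 < δ) :
    StrictMonoOn (Psi N k δ) (Set.Iio 1) := by
  intro a ha b hb hab
  have hN : (0 : ℝ) < N := by exact_mod_cast (by omega : 0 < N)
  simp only [Set.mem_Iio] at ha hb
  unfold Psi
  refine mul_lt_mul_of_pos_left ?_ (by positivity)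
  refine Finset.sum_lt_sum_of_nonempty (Finset.nonempty_Ico.2 hk) ?_
  intro m hm
  rw [Finset.mem_Ico] at hm
  have h1 : (0 : ℝ) < m.choose k := by exact_mod_cast Nat.choose_pos hm.1
  have h2 : (0 : ℝ) < N.choose k := by exact_mod_cast Nat.choose_pos hk.le
  refine mul_lt_mul_of_pos_left ?_ (by positivity)
  have hb' : 0 < 1 - b := by linarith
  refine inv_strictAnti₀ (by positivity) ?_
  exact pow_lt_pow_left₀ (by linarith) hb'.le (by omega)

theorem choose_mul_pow_le (k N m : ℕ) (hkm : k ≤ m) (hmN : m ≤ N) :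
    (m.choose k : ℝ) * (N : ℝ) ^ (N - m) ≤ (N.choose k : ℝ) * ((N : ℝ) - k) ^ (N - m) := by
  induction hmN using Nat.decreasingInduction with
  | self => simp
  | of_succ j hj ih =>
    have ih := ih (by omega)
    have hjN : N - j = (N - (j + 1)) + 1 := by omega
    have hkN : (k : ℝ) ≤ N := by exact_mod_cast (by omega : k ≤ N)
    have hkj : (k : ℝ) ≤ j := by exact_mod_cast hkm
    have hjN' : (j : ℝ) + 1 ≤ N := by exact_mod_cast hj
    have hrec : ((j.choose k : ℕ) : ℝ) * ((j : ℝ) + 1)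
        = ((j + 1).choose k : ℝ) * ((j : ℝ) + 1 - k) := by
      have h := Nat.choose_mul_succ_eq j k
      have h' : ((j.choose k * (j + 1) : ℕ) : ℝ) = (((j + 1).choose k * (j + 1 - k) : ℕ) : ℝ) := by
        rw [h]
      rw [Nat.cast_mul, Nat.cast_mul, Nat.cast_sub (by omega)] at h'
      push_cast at h'
      exact h'
    have hj1 : (0 : ℝ) < (j : ℝ) + 1 := by positivity
    have hstep : (j.choose k : ℝ) * N ≤ ((j + 1).choose k : ℝ) * ((N : ℝ) - k) := by
      have hc : (0 : ℝ) ≤ ((j + 1).choose k : ℝ) := by positivity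
      have : (j.choose k : ℝ) = ((j + 1).choose k : ℝ) * ((j : ℝ) + 1 - k) / ((j : ℝ) + 1) := by
        rw [eq_div_iff hj1.ne']; exact hrec
      rw [this, div_mul_eq_mul_div, div_le_iff₀ hj1, mul_assoc, mul_assoc]
      refine mul_le_mul_of_nonneg_left ?_ hc
      have hk0 : (0 : ℝ) ≤ k := by positivity
      nlinarith
    rw [hjN, pow_succ, pow_succ]
    have hp : (0 : ℝ) ≤ (N : ℝ) ^ (N - (j + 1)) := by positivity
    have hq : (0 : ℝ) ≤ (N : ℝ) - k := by linarith
    calc (j.choose k : ℝ) * ((N : ℝ) ^ (N - (j + 1)) * N)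
        = ((j.choose k : ℝ) * N) * (N : ℝ) ^ (N - (j + 1)) := by ring
      _ ≤ (((j + 1).choose k : ℝ) * ((N : ℝ) - k)) * (N : ℝ) ^ (N - (j + 1)) :=
          mul_le_mul_of_nonneg_right hstep hp
      _ = (((j + 1).choose k : ℝ) * (N : ℝ) ^ (N - (j + 1))) * ((N : ℝ) - k) := by ring
      _ ≤ ((N.choose k : ℝ) * ((N : ℝ) - k) ^ (N - (j + 1))) * ((N : ℝ) - k) :=
          mul_le_mul_of_nonneg_right ih hq
      _ = (N.choose k : ℝ) * (((N : ℝ) - k) ^ (N - (j + 1)) * ((N : ℝ) - k)) := by ring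

theorem psi_left_le {N k : ℕ} {δ : ℝ} (hk : k < N) (hδ : 0 < δ) :
    Psi N k δ ((k : ℝ) / N) ≤ δ := by
  have hN : (0 : ℝ) < N := by exact_mod_cast (by omega : 0 < N)
  have hkN : (0 : ℝ) < (N : ℝ) - k := by
    have : (k : ℝ) < N := by exact_mod_cast hk
    linarith
  have hsum : ∑ m ∈ Finset.Ico k N,
      ((m.choose k : ℝ) / (N.choose k : ℝ)) * ((1 - (k : ℝ) / N) ^ (N - m))⁻¹ ≤ N := by
    calc _ ≤ ∑ m ∈ Finset.Ico k N, (1 : ℝ) := by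
          refine Finset.sum_le_sum ?_
          intro m hm
          rw [Finset.mem_Ico] at hm
          have h2 : (0 : ℝ) < N.choose k := by exact_mod_cast Nat.choose_pos hk.le
          have h := choose_mul_pow_le k N m hm.1 hm.2.le
          have e : 1 - (k : ℝ) / N = ((N : ℝ) - k) / N := by field_simp
          rw [e, div_pow, inv_div, div_mul_div_comm, div_le_one (by positivity)]
          exact h
      _ = ((N - k : ℕ) : ℝ) := by simp
      _ ≤ N := by exact_mod_cast Nat.sub_le N k
  unfold Psi
  calc _ ≤ δ / N * N := mul_le_mul_of_nonneg_left hsum (by positivity)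
    _ = δ := by field_simp

theorem existsUnique_psi_eq_one {N k : ℕ} {δ : ℝ} (hk : k < N) (hδ : 0 < δ) (hδ1 : δ < 1) :
    ∃! ε : ℝ, ε ∈ Set.Icc ((k : ℝ) / N) 1 ∧ Psi N k δ ε = 1 := by
  have hN : (0 : ℝ) < N := by exact_mod_cast (by omega : 0 < N)
  have hkN' : (k : ℝ) < N := by exact_mod_cast hk
  have hkN : (0 : ℝ) < (N : ℝ) - k := by linarith
  have hmono := psi_strictMonoOn hk hδ
  have hone : Psi N k δ 1 = 0 := by
    unfold Psi
    rw [Finset.sum_eq_zero, mul_zero]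
    intro m hm
    rw [Finset.mem_Ico] at hm
    rw [sub_self, zero_pow (by omega), inv_zero, mul_zero]
  have hlt : ∀ ε : ℝ, ε ≤ 1 → Psi N k δ ε = 1 → ε < 1 := by
    intro ε h1 h2
    refine lt_of_le_of_ne h1 ?_
    rintro rfl
    rw [hone] at h2
    exact zero_ne_one h2
  set a : ℝ := δ * ((N : ℝ) - k) / N ^ 2 with ha
  have ha0 : 0 < a := by positivity
  have hab : (k : ℝ) / N ≤ 1 - a := by
    have h1 : a ≤ ((N : ℝ) - k) / N := by
      rw [ha, div_le_div_iff₀ (by positivity) hN]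
      have hN1 : (1 : ℝ) ≤ N := by exact_mod_cast (by omega : 1 ≤ N)
      nlinarith [mul_pos hkN hN, mul_le_mul_of_nonneg_left hδ1.le (mul_pos hkN hN).le]
    have h2 : ((N : ℝ) - k) / N = 1 - k / N := by field_simp
    linarith
  have hright : 1 ≤ Psi N k δ (1 - a) := by
    have hterm : ((N : ℝ) - k) / N * a⁻¹ ≤ ∑ m ∈ Finset.Ico k N,
        ((m.choose k : ℝ) / (N.choose k : ℝ)) * ((1 - (1 - a)) ^ (N - m))⁻¹ := by
      have hmem : N - 1 ∈ Finset.Ico k N := by rw [Finset.mem_Ico]; omega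
      refine le_trans (le_of_eq ?_) (Finset.single_le_sum (f := fun m : ℕ =>
        ((m.choose k : ℝ) / (N.choose k : ℝ)) * ((1 - (1 - a)) ^ (N - m))⁻¹) ?_ hmem)
      · have e1 : N - (N - 1) = 1 := by omega
        have h2 : (0 : ℝ) < N.choose k := by exact_mod_cast Nat.choose_pos hk.le
        have h := Nat.choose_mul_succ_eq (N - 1) k
        rw [Nat.sub_add_cancel (by omega : 1 ≤ N)] at h
        have h' : (((N - 1).choose k * N : ℕ) : ℝ) = ((N.choose k * (N - k) : ℕ) : ℝ) := by rw [h]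
        rw [Nat.cast_mul, Nat.cast_mul, Nat.cast_sub hk.le] at h'
        simp only [e1, pow_one, sub_sub_cancel]
        congr 1
        rw [div_eq_div_iff hN.ne' h2.ne', h']
        ring
      · intro m _
        have : (0 : ℝ) ≤ 1 - (1 - a) := by linarith
        positivity
    unfold Psi
    calc (1 : ℝ) = δ / N * (((N : ℝ) - k) / N * a⁻¹) := by rw [ha]; field_simp
      _ ≤ _ := mul_le_mul_of_nonneg_left hterm (by positivity)
  have hcont : ContinuousOn (Psi N k δ) (Set.Icc ((k : ℝ) / N) (1 - a)) := by
    unfold Psi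
    refine ContinuousOn.mul continuousOn_const (continuousOn_finsetSum _ ?_)
    intro m _
    refine ContinuousOn.mul continuousOn_const (ContinuousOn.inv₀ (by fun_prop) ?_)
    intro x hx
    have : 0 < 1 - x := by linarith [hx.2]
    positivity
  obtain ⟨ε, hε, hε1⟩ := intermediate_value_Icc hab hcont
    (show (1 : ℝ) ∈ Set.Icc _ _ from ⟨(psi_left_le hk hδ).trans hδ1.le, hright⟩)
  refine ⟨ε, ⟨⟨hε.1, by linarith [hε.2]⟩, hε1⟩, ?_⟩
  rintro y ⟨hy, hy1⟩
  exact hmono.injOn (hlt y hy.2 hy1) (show ε < 1 by linarith [hε.2]) (hy1.trans hε1.symm)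

theorem epsBar_spec {N k : ℕ} {δ : ℝ} (hk : k < N) (hδ : 0 < δ) (hδ1 : δ < 1) :
    epsBar k δ N ∈ Set.Icc ((k : ℝ) / N) 1 ∧ Psi N k δ (epsBar k δ N) = 1 := by
  obtain ⟨ε, hε, hu⟩ := existsUnique_psi_eq_one hk hδ hδ1
  have hs : {ε : ℝ | ε ∈ Set.Icc ((k : ℝ) / N) 1 ∧ Psi N k δ ε = 1} = {ε} := by
    ext y
    exact ⟨fun h => hu y h, fun h => by rw [Set.mem_singleton_iff] at h; rw [h]; exact hε⟩
  have he : epsBar k δ N = ε := by rw [epsBar, if_pos hk, hs, csInf_singleton]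
  rw [he]
  exact hε

end Bound

section MetaAlgorithm

variable {Z Dec : Type*}

open Classical in
/-- The maximal element of a nonempty list with respect to the total order `le`. -/
noncomputable def listMax (le : Z → Z → Prop) (l : List Z) (hl : l ≠ []) : Z :=
  l.tail.foldl (fun a b => if le a b then b else a) (l.head hl)

open Classical in
theorem foldl_max_mem (le : Z → Z → Prop) (l : List Z) (a : Z) :
    l.foldl (fun a b => if le a b then b else a) a ∈ a :: l := by
  induction l generalizing a with
  | nil => simp
  | cons b l ih =>
    rw [List.foldl_cons]
    have h := ih (if le a b then b else a)
    split_ifs at h ⊢ with hab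
    · exact List.mem_cons_of_mem _ h
    · rcases List.mem_cons.1 h with h | h
      · rw [h]; exact List.mem_cons_self
      · exact List.mem_cons_of_mem _ (List.mem_cons_of_mem _ h)

theorem listMax_mem (le : Z → Z → Prop) (l : List Z) (hl : l ≠ []) : listMax le l hl ∈ l := by
  have h := foldl_max_mem le l.tail (l.head hl)
  rw [List.cons_head_tail] at h
  exact h

open Classical in
/-- The main loop of the meta-algorithm Pick-to-Learn, started from the training list `T` and the
decision `h`.  Here `D` is the dataset (a list), `L` the synthesis algorithm, `φ h z` says that the
decision `h` satisfies the property of interest at `z`, and `le T h y z` says that, when the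
training list is `T` and the decision is `h`, the point `z` is at least as unsatisfied as `y`.
`D.diff T` removes from `D` the elements of `T`, with multiplicity. -/
noncomputable def loop (L : List Z → Dec) (φ : Dec → Z → Prop)
    (le : List Z → Dec → Z → Z → Prop) (D : List Z) (T : List Z) (h : Dec) : Dec × List Z :=
  if hviol : ∃ z ∈ D.diff T, ¬ φ h z then
    let zbar := listMax (le T h) (D.diff T)
      (List.ne_nil_of_mem hviol.choose_spec.1)
    loop L φ le D (T ++ [zbar]) (L (T ++ [zbar]))
  else (h, T)
termination_by (D.diff T).length
decreasing_by
  rw [List.diff_append, List.diff_cons, List.diff_nil,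
    List.length_erase_of_mem (listMax_mem _ _ _)]
  have : 0 < (D.diff T).length :=
    List.length_pos_of_mem hviol.choose_spec.1
  omega

/-- `P2L(D) = (h, T)`: the loop is started with `T = ∅` and the initial decision `h₀`. -/
noncomputable def run (L : List Z → Dec) (φ : Dec → Z → Prop)
    (le : List Z → Dec → Z → Z → Prop) (h₀ : Dec) (D : List Z) : Dec × List Z :=
  loop L φ le D [] h₀

end MetaAlgorithm

section OptimalControl

/-- An uncertainty instance `z = (x₀, w)` with `w = (w_0, …, w_{H-1})`. -/
abbrev Uncertainty (nx nw H : ℕ) : Type :=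
  (Fin nx → ℝ) × (Fin H → Fin nw → ℝ)

/-- A state-feedback policy: at each time `t = 0, …, H` it maps the state history
`(x_0, …, x_t)` to an input `u_t`. -/
abbrev Policy (nx nu H : ℕ) : Type :=
  (t : Fin (H + 1)) → (Fin ((t : ℕ) + 1) → Fin nx → ℝ) → (Fin nu → ℝ)

variable {nx nu nw H : ℕ}

/-- The state history `(x_0, …, x_t)` of `x_{t+1} = f_t(x_t, u_t, w_t)` in closed loop with
`u_t = π_t(x_0, …, x_t)`. -/
def history (f : Fin H → (Fin nx → ℝ) → (Fin nu → ℝ) → (Fin nw → ℝ) → (Fin nx → ℝ))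
    (π : Policy nx nu H) (z : Uncertainty nx nw H) :
    (t : ℕ) → t ≤ H → (Fin (t + 1) → Fin nx → ℝ)
  | 0, _ => fun _ => z.1
  | t + 1, ht =>
    let past : Fin (t + 1) → Fin nx → ℝ := history f π z t (Nat.le_of_succ_le ht)
    Fin.snoc (α := fun _ => Fin nx → ℝ) past
      (f ⟨t, ht⟩ (past (Fin.last t)) (π ⟨t, Nat.lt_succ_of_le (Nat.le_of_succ_le ht)⟩ past)
        (z.2 ⟨t, ht⟩))

/-- The cost `J(π, z) = ∑_{t=0}^H ℓ_t(x_t, π_t(x_0, …, x_t))`. -/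
def cost (f : Fin H → (Fin nx → ℝ) → (Fin nu → ℝ) → (Fin nw → ℝ) → (Fin nx → ℝ))
    (ℓ : Fin (H + 1) → (Fin nx → ℝ) → (Fin nu → ℝ) → ℝ)
    (π : Policy nx nu H) (z : Uncertainty nx nw H) : ℝ :=
  ∑ t : Fin (H + 1),
    ℓ t (history f π z t (Nat.le_of_lt_succ t.isLt) (Fin.last t))
      (π t (history f π z t (Nat.le_of_lt_succ t.isLt)))

/-- The order of dissatisfaction induced by a cost `c`: higher cost means higher dissatisfaction,
and ties are broken by the order `tie`. -/
def dissatisfactionLE {Z : Type*} (c : Z → ℝ) (tie : Z → Z → Prop) (y z : Z) : Prop :=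
  c y < c z ∨ (c y = c z ∧ tie y z)

/-- The output `(θ, T)` of P2L for data-driven optimal control, run on the list `D`: decisions are
parameters `θ` of the policies `π θ`, `L` is the synthesis algorithm, `θ₀` the initial parameter,
the property of interest is `J(π^θ, z) ≤ J̄`, the degree of dissatisfaction is the cost, and ties
are broken by the total order `tie T`. -/
noncomputable def controlRun {nθ : ℕ}
    (f : Fin H → (Fin nx → ℝ) → (Fin nu → ℝ) → (Fin nw → ℝ) → (Fin nx → ℝ))
    (ℓ : Fin (H + 1) → (Fin nx → ℝ) → (Fin nu → ℝ) → ℝ)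
    (π : (Fin nθ → ℝ) → Policy nx nu H) (Jbar : ℝ)
    (tie : List (Uncertainty nx nw H) → Uncertainty nx nw H → Uncertainty nx nw H → Prop)
    (L : List (Uncertainty nx nw H) → (Fin nθ → ℝ)) (θ₀ : Fin nθ → ℝ)
    (D : List (Uncertainty nx nw H)) : (Fin nθ → ℝ) × List (Uncertainty nx nw H) :=
  run L (fun θ z => cost f ℓ (π θ) z ≤ Jbar)
    (fun T θ => dissatisfactionLE (cost f ℓ (π θ)) (tie T)) θ₀ D

end OptimalControl

end P2L

/-! The main loop picks, at each step, the greatest of the remaining points. A list `T` of data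
points is what the loop picks precisely when (i) its points violate the property at their turn and
dominate their successors (`Picks`), and (ii) each of the other points of the dataset is dominated
by each point of `T` at its turn and does not violate the property at the end (`Unpicked`). The
first condition involves `T` only, and the second one is imposed on each of the other points
separately. For an i.i.d. sample of `m` points this means that the first `k` points are picked, in
this order, with probability `∫_C q(t)^(m - k)`, where `C` is the set of lists `t` of length `k`
with (i), and `q(t)` is the probability that a fresh point satisfies (ii) relative to `t`
(`measure_pickEvent`). The same holds for any other `k` indices in any order, and distinct lists of
indices cannot be picked simultaneously, so that
`∑ₖ m (m - 1) ⋯ (m - k + 1) ∫_C q^(m - k) ≤ 1` for every `m`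
(`sum_descFactorial_mul_lintegral_le_one`). The equation defining `epsBar k δ N` says that, where
`1 - q > epsBar k δ N`, the term with `m = N` is at most `δ / N` times the sum of the terms with
`k ≤ m < N` (`descFactorial_mul_pow_le`). Summing over `k` bounds the probability that
`1 - q > epsBar k δ N` by `δ` (`measure_iUnion_pickEvent_le`). Since points with (ii) do not violate
the property, the probability of violation is at most `1 - q`.

The picked indices are ambiguous if the sample has repeated points. Therefore every point is given
an independent uniform mark, and copies of a point are compared by their marks (`markedLE`). Marked
points are almost surely distinct, and forgetting the marks turns lists of picked marked points into
lists of picked points, which are unique (`Picks.unique`) and hence those of the loop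
(`loop_eq_of_picks`). The initial parameter is a function of data independent of the other points,
and the bound is proved for each of its values (`measure_badSet_le`). -/

namespace P2L

/-! ### Picking points from a dataset -/

section Selection

variable {α β : Type*}

/-- `Picks le viol S T`: once the points of `S` have been picked, the points of `T` can be picked
next, in this order, as far as they are concerned among themselves: each of them violates the
property at its turn and dominates the points of `T` that come after it.  Both the order `le` and
the violation predicate `viol` depend on the list of points picked so far. -/
def Picks (le : List α → α → α → Prop) (viol : List α → α → Prop) :
    List α → List α → Prop
  | _, [] => True
  | S, t :: T => viol S t ∧ (∀ x ∈ T, le S x t) ∧ Picks le viol (S ++ [t]) T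

/-- `Unpicked le viol S T x`: the presence of `x` in the dataset does not interfere with the picking
of `T` after `S`, that is, `x` is dominated by each point of `T` at its turn and does not violate
the property when all of `S ++ T` has been picked. -/
def Unpicked (le : List α → α → α → Prop) (viol : List α → α → Prop) :
    List α → List α → α → Prop
  | S, [], x => ¬ viol S x
  | S, t :: T, x => le S x t ∧ Unpicked le viol (S ++ [t]) T x

variable {le : List α → α → α → Prop} {viol : List α → α → Prop}

theorem Unpicked.not_viol {S T : List α} {x : α} (h : Unpicked le viol S T x) :
    ¬ viol (S ++ T) x := by
  induction T generalizing S with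
  | nil => simpa [Unpicked] using h
  | cons t T ih => simpa using ih h.2

theorem Picks.map {le' : List β → β → β → Prop} {viol' : List β → β → Prop} (g : α → β)
    (hle : ∀ S a b, le S a b → le' (S.map g) (g a) (g b))
    (hviol : ∀ S a, viol' (S.map g) (g a) ↔ viol S a) {S T : List α} (h : Picks le viol S T) :
    Picks le' viol' (S.map g) (T.map g) := by
  induction T generalizing S with
  | nil => trivial
  | cons t T ih =>
    refine ⟨(hviol _ _).2 h.1, ?_, by simpa using ih h.2.2⟩
    intro x hx
    obtain ⟨a, ha, rfl⟩ := List.mem_map.1 hx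
    exact hle _ _ _ (h.2.1 a ha)

theorem Unpicked.map {le' : List β → β → β → Prop} {viol' : List β → β → Prop} (g : α → β)
    (hle : ∀ S a b, le S a b → le' (S.map g) (g a) (g b))
    (hviol : ∀ S a, viol' (S.map g) (g a) ↔ viol S a) {S T : List α} {x : α}
    (h : Unpicked le viol S T x) : Unpicked le' viol' (S.map g) (T.map g) (g x) := by
  induction T generalizing S with
  | nil => exact fun h' => h ((hviol _ _).1 h')
  | cons t T ih => exact ⟨hle _ _ _ h.1, by simpa using ih h.2⟩

theorem exists_greatest {r : α → α → Prop} (htot : ∀ a b, r a b ∨ r b a)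
    (htrans : ∀ a b c, r a b → r b c → r a c) (D : List α) (hD : D ≠ []) :
    ∃ t ∈ D, ∀ x ∈ D, r x t := by
  induction D with
  | nil => exact absurd rfl hD
  | cons a D ih =>
    have hrefl : r a a := (htot a a).elim id id
    by_cases h : D = []
    · subst h
      exact ⟨a, by simp, by simpa using hrefl⟩
    · obtain ⟨t, ht, hmax⟩ := ih h
      rcases htot a t with h1 | h1
      · exact ⟨t, by simp [ht], by simpa [h1] using hmax⟩
      · exact ⟨a, by simp, by simpa [hrefl] using fun x hx => htrans _ _ _ (hmax x hx) h1⟩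

/-- Greedy picking terminates: every dataset splits into picked and unpicked points. -/
theorem exists_picks (htot : ∀ S a b, le S a b ∨ le S b a)
    (htrans : ∀ S a b c, le S a b → le S b c → le S a c)
    (hup : ∀ S a b, le S a b → viol S a → viol S b) (D S : List α) :
    ∃ T R, (T ++ R).Perm D ∧ Picks le viol S T ∧ ∀ x ∈ R, Unpicked le viol S T x := by
  classical
  induction hn : D.length generalizing D S with
  | zero =>
    rw [List.length_eq_zero_iff] at hn
    subst hn
    exact ⟨[], [], by simp, trivial, by simp⟩
  | succ n ih =>
    by_cases hv : ∃ x ∈ D, viol S x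
    · obtain ⟨x, hx, hxv⟩ := hv
      obtain ⟨t, ht, hmax⟩ := exists_greatest (htot S) (htrans S) D (List.ne_nil_of_mem hx)
      obtain ⟨T, R, hp, hT, hR⟩ := ih (D.erase t) (S ++ [t]) (by
        rw [List.length_erase_of_mem ht, hn]; rfl)
      have hsub : ∀ x ∈ T ++ R, le S x t := fun x hx =>
        hmax x (List.mem_of_mem_erase (hp.subset hx))
      refine ⟨t :: T, R, ?_, ⟨hup _ _ _ (hmax x hx) hxv, ?_, hT⟩, ?_⟩
      · exact (hp.cons t).trans (List.perm_cons_erase ht).symm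
      · exact fun x hx => hsub x (by simp [hx])
      · exact fun x hx => ⟨hsub x (by simp [hx]), hR x hx⟩
    · push Not at hv
      exact ⟨[], D, by simp, trivial, hv⟩

/-- The list of picked points is determined by the dataset, regardless of the order in which the
dataset is presented. -/
theorem Picks.unique (hanti : ∀ S a b, le S a b → le S b a → a = b)
    (hrefl : ∀ S a, le S a a)
    {S T R T' R' : List α} (hp : (T ++ R).Perm (T' ++ R'))
    (hT : Picks le viol S T) (hR : ∀ x ∈ R, Unpicked le viol S T x)
    (hT' : Picks le viol S T') (hR' : ∀ x ∈ R', Unpicked le viol S T' x) : T = T' := by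
  induction T generalizing S T' with
  | nil =>
    cases T' with
    | nil => rfl
    | cons t' T' => exact absurd hT'.1 (hR t' (hp.symm.subset (by simp)))
  | cons t T ih =>
    cases T' with
    | nil => exact absurd hT.1 (hR' t (hp.subset (by simp)))
    | cons t' T' =>
      have h1 : ∀ x ∈ (t :: T) ++ R, le S x t := by
        intro x hx
        simp only [List.cons_append, List.mem_cons, List.mem_append] at hx
        rcases hx with rfl | hx | hx
        · exact hrefl _ _
        · exact hT.2.1 x hx
        · exact (hR x hx).1
      have h2 : ∀ x ∈ (t' :: T') ++ R', le S x t' := by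
        intro x hx
        simp only [List.cons_append, List.mem_cons, List.mem_append] at hx
        rcases hx with rfl | hx | hx
        · exact hrefl _ _
        · exact hT'.2.1 x hx
        · exact (hR' x hx).1
      have htt : t = t' :=
        hanti S _ _ (h2 t (hp.subset (by simp))) (h1 t' (hp.symm.subset (by simp)))
      subst htt
      rw [ih (List.perm_cons t |>.1 (by simpa using hp)) hT.2.2 (fun x hx => (hR x hx).2) hT'.2.2
        (fun x hx => (hR' x hx).2)]

end Selection

/-! ### The loop of the meta-algorithm -/

section Run

variable {Z Dec : Type*}

theorem le_foldl_max {r : Z → Z → Prop} (htot : ∀ a b, r a b ∨ r b a)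
    (htrans : ∀ a b c, r a b → r b c → r a c) (l : List Z) (a : Z) :
    ∀ x ∈ a :: l, r x (l.foldl (fun a b => open Classical in if r a b then b else a) a) := by
  induction l generalizing a with
  | nil => simpa using (htot a a).elim id id
  | cons b l ih =>
    intro x hx
    rw [List.foldl_cons]
    have hrefl : ∀ a, r a a := fun a => (htot a a).elim id id
    have ih' := ih (open Classical in if r a b then b else a)
    have h0 := ih' _ List.mem_cons_self
    simp only [List.mem_cons] at hx
    rcases hx with rfl | rfl | hx
    · refine htrans _ _ _ ?_ h0
      split_ifs with h
      exacts [h, hrefl _]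
    · refine htrans _ _ _ ?_ h0
      split_ifs with h
      exacts [hrefl _, (htot _ _).resolve_left h]
    · exact ih' x (List.mem_cons_of_mem _ hx)

theorem le_listMax {r : Z → Z → Prop} (htot : ∀ a b, r a b ∨ r b a)
    (htrans : ∀ a b c, r a b → r b c → r a c) (l : List Z) (hl : l ≠ []) :
    ∀ x ∈ l, r x (listMax r l hl) := by
  intro x hx
  refine le_foldl_max htot htrans l.tail (l.head hl) x ?_
  rwa [List.cons_head_tail]

variable {L : List Z → Dec} {φ : Dec → Z → Prop} {le : List Z → Dec → Z → Z → Prop}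

/-- The loop of the meta-algorithm returns the picked points.  Here `dec T` is the decision held
when the training list is `T`; it may differ from `L T` only for `T = []`. -/
theorem loop_eq_of_picks (dec : List Z → Dec) (hdec : ∀ T z, dec (T ++ [z]) = L (T ++ [z]))
    (hanti : ∀ S a b, le S (dec S) a b → le S (dec S) b a → a = b)
    (htot : ∀ S a b, le S (dec S) a b ∨ le S (dec S) b a)
    (htrans : ∀ S a b c, le S (dec S) a b → le S (dec S) b c → le S (dec S) a c)
    {D S T R : List Z}
    (hp : (T ++ R).Perm (open Classical in D.diff S))
    (hT : Picks (fun S => le S (dec S)) (fun S z => ¬ φ (dec S) z) S T)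
    (hR : ∀ x ∈ R, Unpicked (fun S => le S (dec S)) (fun S z => ¬ φ (dec S) z) S T x) :
    loop L φ le D S (dec S) = (dec (S ++ T), S ++ T) := by
  classical
  induction T generalizing S with
  | nil =>
    have h : ¬ ∃ z ∈ D.diff S, ¬ φ (dec S) z := by
      rintro ⟨z, hz, hv⟩
      exact hR z (by simpa using hp.symm.subset hz) hv
    rw [loop, dif_neg h]
    simp
  | cons t T ih =>
    have ht : t ∈ D.diff S := hp.subset (by simp)
    have h : ∃ z ∈ D.diff S, ¬ φ (dec S) z := ⟨t, ht, hT.1⟩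
    have hne : D.diff S ≠ [] := List.ne_nil_of_mem ht
    have hmax : listMax (le S (dec S)) (D.diff S) hne = t := by
      refine hanti S _ _ ?_ (le_listMax (htot S) (htrans S) _ hne t ht)
      have hmem := hp.symm.subset (listMax_mem (le S (dec S)) _ hne)
      simp only [List.cons_append, List.mem_cons, List.mem_append] at hmem
      rcases hmem with h1 | h1 | h1
      · rw [h1]; exact (htot S t t).elim id id
      · exact hT.2.1 _ h1
      · exact (hR _ h1).1
    rw [loop, dif_pos h]
    simp only [hmax]
    rw [← hdec, ih (S := S ++ [t]) ?_ hT.2.2 (fun x hx => (hR x hx).2)]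
    · simp
    · rw [List.diff_append, List.diff_cons, List.diff_nil]
      simpa using hp.erase t

end Run

/-! ### The probabilistic bound -/

section Core

open MeasureTheory

/-- The inequality between polynomials that the threshold `epsBar` is designed for. -/
theorem descFactorial_mul_pow_le {N k : ℕ} {δ q : ℝ} (hk : k < N) (hδ : 0 < δ) (hδ1 : δ < 1)
    (hq : 0 ≤ q) (h : epsBar k δ N < 1 - q) :
    (N.descFactorial k : ℝ) * q ^ (N - k) ≤
      δ / N * ∑ m ∈ Finset.Ico k N, (m.descFactorial k : ℝ) * q ^ (m - k) := by
  rcases hq.eq_or_lt with rfl | hq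
  · rw [zero_pow (by omega), mul_zero]
    positivity
  have hc : (0 : ℝ) < N.choose k := by exact_mod_cast Nat.choose_pos hk.le
  obtain ⟨-, hspec⟩ := epsBar_spec hk hδ hδ1
  have hPsi : 1 ≤ Psi N k δ (1 - q) := by
    have h1 : epsBar k δ N ∈ Set.Iio 1 := Set.mem_Iio.2 (by linarith)
    have h2 : 1 - q ∈ Set.Iio 1 := Set.mem_Iio.2 (by linarith)
    exact hspec.ge.trans (psi_strictMonoOn hk hδ h1 h2 h).le
  have hpos : 0 ≤ (N.descFactorial k : ℝ) * q ^ (N - k) := by positivity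
  calc (N.descFactorial k : ℝ) * q ^ (N - k)
      ≤ ((N.descFactorial k : ℝ) * q ^ (N - k)) * Psi N k δ (1 - q) :=
        le_mul_of_one_le_right hpos hPsi
    _ = δ / N * ∑ m ∈ Finset.Ico k N, (m.descFactorial k : ℝ) * q ^ (m - k) := by
        unfold Psi
        rw [mul_left_comm, Finset.mul_sum]
        congr 1
        refine Finset.sum_congr rfl fun m hm => ?_
        rw [Finset.mem_Ico] at hm
        have hpow : q ^ (N - k) = q ^ (m - k) * q ^ (N - m) := by
          rw [← pow_add]; congr 1; omega
        rw [Nat.descFactorial_eq_factorial_mul_choose, Nat.descFactorial_eq_factorial_mul_choose,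
          hpow, sub_sub_cancel]
        push_cast
        field_simp

/-- Splitting the indices of an i.i.d. family into two classes gives two independent i.i.d.
families. -/
theorem measurePreserving_pi_comp_sum {X α β γ : Type*} [MeasurableSpace X] [Fintype α]
    [Fintype β] [Fintype γ] (μ : Measure X) [SigmaFinite μ] (e : α ⊕ β ≃ γ) :
    MeasurePreserving (fun x : γ → X => (fun a => x (e (.inl a)), fun b => x (e (.inr b))))
      (Measure.pi fun _ => μ) ((Measure.pi fun _ => μ).prod (Measure.pi fun _ => μ)) := by
  have h1 := (measurePreserving_piCongrLeft (α := fun _ : γ => X) (fun _ => μ) e).symm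
  have h2 := measurePreserving_sumPiEquivProdPi (X := fun _ : α ⊕ β => X) (fun _ => μ)
  exact h2.comp h1

variable {X : Type*} [MeasurableSpace X]

/-- The event that the points with indices `σ 0, …, σ (k - 1)` form a list in `C` and that each of
the other points satisfies the condition `O` relative to this list. -/
def pickEvent {m k : ℕ} (C : Set (Fin k → X)) (O : Set ((Fin k → X) × X)) (σ : Fin k ↪ Fin m) :
    Set (Fin m → X) :=
  {x | x ∘ σ ∈ C ∧ ∀ j ∉ Set.range σ, (x ∘ σ, x j) ∈ O}

theorem measurableSet_pickEvent {m k : ℕ} {C : Set (Fin k → X)} {O : Set ((Fin k → X) × X)}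
    (hC : MeasurableSet C) (hO : MeasurableSet O) (σ : Fin k ↪ Fin m) :
    MeasurableSet (pickEvent C O σ) := by
  have hσ : Measurable fun x : Fin m → X => x ∘ σ := by
    rw [measurable_pi_iff]; exact fun i => measurable_pi_apply (σ i)
  have h : pickEvent C O σ = (fun x => x ∘ σ) ⁻¹' C ∩
      ⋂ (j) (_ : j ∉ Set.range σ), (fun x => (x ∘ σ, x j)) ⁻¹' O := by
    ext x
    simp [pickEvent]
  rw [h]
  exact (hσ hC).inter <| MeasurableSet.iInter fun j => MeasurableSet.iInter fun _ =>
    (hσ.prodMk (measurable_pi_apply j)) hO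

variable (μ : Measure X) [IsProbabilityMeasure μ]

/-- Given the list of picked points, the other points are independent of it and of each other;
hence the power. -/
theorem measure_pickEvent {m k : ℕ} {C : Set (Fin k → X)} {O : Set ((Fin k → X) × X)}
    (hC : MeasurableSet C) (hO : MeasurableSet O) (σ : Fin k ↪ Fin m) :
    Measure.pi (fun _ => μ) (pickEvent C O σ) =
      ∫⁻ t in C, μ (Prod.mk t ⁻¹' O) ^ (m - k) ∂Measure.pi (fun _ => μ) := by
  classical
  let e : Fin k ⊕ {j // j ∉ Set.range σ} ≃ Fin m :=
    ((Equiv.ofInjective σ σ.injective).sumCongr (Equiv.refl _)).trans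
      (Equiv.sumCompl (· ∈ Set.range σ))
  have hmp := measurePreserving_pi_comp_sum μ e
  have hcard : Fintype.card {j // j ∉ Set.range σ} = m - k := by
    have := Fintype.card_congr e
    rw [Fintype.card_sum, Fintype.card_fin, Fintype.card_fin] at this
    omega
  let A : Set ((Fin k → X) × ({j // j ∉ Set.range σ} → X)) :=
    {p | p.1 ∈ C ∧ ∀ b, (p.1, p.2 b) ∈ O}
  have hA : MeasurableSet A := by
    have h : A = Prod.fst ⁻¹' C ∩ ⋂ b,
        (fun p : (Fin k → X) × ({j // j ∉ Set.range σ} → X) => (p.1, p.2 b)) ⁻¹' O := by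
      ext p
      simp [A]
    rw [h]
    exact (measurable_fst hC).inter <| MeasurableSet.iInter fun b =>
      (measurable_fst.prodMk ((measurable_pi_apply b).comp measurable_snd)) hO
  have hpre : pickEvent C O σ =
      (fun x : Fin m → X => (fun a => x (e (.inl a)), fun b => x (e (.inr b)))) ⁻¹' A := by
    ext x
    refine and_congr Iff.rfl ⟨fun h b => h b b.2, fun h j hj => h ⟨j, hj⟩⟩
  rw [hpre, hmp.measure_preimage hA.nullMeasurableSet, Measure.prod_apply hA,
    ← lintegral_indicator hC]
  refine lintegral_congr fun t => ?_
  by_cases ht : t ∈ C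
  · have : Prod.mk t ⁻¹' A = Set.univ.pi fun _ => Prod.mk t ⁻¹' O := by
      ext r
      simp [A, ht]
    rw [Set.indicator_of_mem ht, this, Measure.pi_pi, Finset.prod_const, Finset.card_univ, hcard]
  · have : Prod.mk t ⁻¹' A = ∅ := by
      ext r
      simp [A, ht]
    rw [Set.indicator_of_notMem ht, this, measure_empty]

/-- If at most one list of indices can be picked, the probabilities of picking given lists sum to
at most one. -/
theorem sum_descFactorial_mul_lintegral_le_one {C : ∀ k, Set (Fin k → X)}
    {O : ∀ k, Set ((Fin k → X) × X)} (hC : ∀ k, MeasurableSet (C k))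
    (hO : ∀ k, MeasurableSet (O k)) (m : ℕ)
    (hdisj : Pairwise fun a b : Σ k, Fin k ↪ Fin m =>
      AEDisjoint (Measure.pi fun _ => μ) (pickEvent (C a.1) (O a.1) a.2)
        (pickEvent (C b.1) (O b.1) b.2)) :
    ∑ k ∈ Finset.range (m + 1), (m.descFactorial k : ENNReal) *
      ∫⁻ t in C k, μ (Prod.mk t ⁻¹' O k) ^ (m - k) ∂Measure.pi (fun _ => μ) ≤ 1 := by
  have h := sum_measure_le_measure_univ (μ := Measure.pi fun _ : Fin m => μ)
    (s := (Finset.range (m + 1)).sigma fun k => (Finset.univ : Finset (Fin k ↪ Fin m)))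
    (t := fun a => pickEvent (C a.1) (O a.1) a.2)
    (fun a _ => (measurableSet_pickEvent (hC _) (hO _) _).nullMeasurableSet)
    (fun a _ b _ hab => hdisj hab)
  rw [Finset.sum_sigma, measure_univ] at h
  refine le_trans (le_of_eq (Finset.sum_congr rfl fun k _ => ?_)) h
  simp only [measure_pickEvent μ (hC k) (hO k)]
  rw [Finset.sum_const, Finset.card_univ, Fintype.card_embedding_eq, Fintype.card_fin,
    Fintype.card_fin, nsmul_eq_mul]

/-- The compression bound: outside an event of probability at most `δ`, the conditional
probability that a fresh point would interfere with the list of `k` picked points is at most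
`epsBar k δ N`. -/
theorem measure_iUnion_pickEvent_le {C : ∀ k, Set (Fin k → X)}
    {O : ∀ k, Set ((Fin k → X) × X)} (hC : ∀ k, MeasurableSet (C k))
    (hO : ∀ k, MeasurableSet (O k))
    (hdisj : ∀ m, Pairwise fun a b : Σ k, Fin k ↪ Fin m =>
      AEDisjoint (Measure.pi fun _ => μ) (pickEvent (C a.1) (O a.1) a.2)
        (pickEvent (C b.1) (O b.1) b.2))
    {N : ℕ} {δ : ℝ} (hδ : 0 < δ) (hδ1 : δ < 1) :
    Measure.pi (fun _ => μ) (⋃ k, ⋃ σ : Fin k ↪ Fin N,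
      pickEvent (C k ∩ {t | epsBar k δ N < 1 - μ.real (Prod.mk t ⁻¹' O k)}) (O k) σ) ≤
        ENNReal.ofReal δ := by
  set B : ∀ k, Set (Fin k → X) :=
    fun k => C k ∩ {t | epsBar k δ N < 1 - μ.real (Prod.mk t ⁻¹' O k)} with hB
  have hq : ∀ k, Measurable fun t => μ (Prod.mk t ⁻¹' O k) := fun k =>
    measurable_measure_prodMk_left (hO k)
  have hBm : ∀ k, MeasurableSet (B k) := fun k =>
    (hC k).inter (measurableSet_lt measurable_const (measurable_const.sub (hq k).ennreal_toReal))
  set I : ℕ → ℕ → ENNReal := fun m k =>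
    ∫⁻ t in C k, μ (Prod.mk t ⁻¹' O k) ^ (m - k) ∂Measure.pi (fun _ => μ) with hI
  have hsub : (⋃ k, ⋃ σ : Fin k ↪ Fin N, pickEvent (B k) (O k) σ) ⊆
      ⋃ k ∈ Finset.range N, ⋃ σ : Fin k ↪ Fin N, pickEvent (B k) (O k) σ := by
    intro x hx
    simp only [Set.mem_iUnion, Finset.mem_range] at hx ⊢
    obtain ⟨k, σ, hx⟩ := hx
    have hkN : k ≤ N := by simpa using Fintype.card_le_of_embedding σ
    -- The threshold is `1` when all `N` points are picked, so this case does not occur.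
    refine ⟨k, lt_of_le_of_ne hkN ?_, σ, hx⟩
    rintro rfl
    have h1 : epsBar k δ k < 1 - μ.real (Prod.mk (x ∘ σ) ⁻¹' O k) := hx.1.2
    rw [epsBar, if_neg (lt_irrefl k)] at h1
    linarith [measureReal_nonneg (μ := μ) (s := Prod.mk (x ∘ σ) ⁻¹' O k)]
  have hpt : ∀ k < N, ∀ t ∈ B k,
      (N.descFactorial k : ENNReal) * μ (Prod.mk t ⁻¹' O k) ^ (N - k) ≤
      ENNReal.ofReal (δ / N) * ∑ m ∈ Finset.Ico k N,
        (m.descFactorial k : ENNReal) * μ (Prod.mk t ⁻¹' O k) ^ (m - k) := by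
    intro k hk t ht
    have h := ENNReal.ofReal_le_ofReal
      (descFactorial_mul_pow_le hk hδ hδ1 measureReal_nonneg ht.2)
    have hcast : ∀ m j : ℕ, ENNReal.ofReal
        ((m.descFactorial k : ℝ) * μ.real (Prod.mk t ⁻¹' O k) ^ j) =
          (m.descFactorial k : ENNReal) * μ (Prod.mk t ⁻¹' O k) ^ j := by
      intro m j
      rw [ENNReal.ofReal_mul (by positivity), ENNReal.ofReal_natCast,
        ENNReal.ofReal_pow measureReal_nonneg, ofReal_measureReal]
    rw [hcast, ENNReal.ofReal_mul (by positivity), ENNReal.ofReal_sum_of_nonneg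
      (fun m _ => by positivity)] at h
    simpa only [hcast] using h
  have hk : ∀ k < N, Measure.pi (fun _ => μ) (⋃ σ : Fin k ↪ Fin N, pickEvent (B k) (O k) σ) ≤
      ENNReal.ofReal (δ / N) * ∑ m ∈ Finset.Ico k N, (m.descFactorial k : ENNReal) * I m k := by
    intro k hk
    calc _ ≤ ∑ σ : Fin k ↪ Fin N, Measure.pi (fun _ => μ) (pickEvent (B k) (O k) σ) :=
          measure_iUnion_fintype_le _ _
      _ = ∫⁻ t in B k, (N.descFactorial k : ENNReal) * μ (Prod.mk t ⁻¹' O k) ^ (N - k)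
            ∂Measure.pi (fun _ => μ) := by
          simp only [measure_pickEvent μ (hBm k) (hO k)]
          rw [Finset.sum_const, Finset.card_univ, Fintype.card_embedding_eq, Fintype.card_fin,
            Fintype.card_fin, nsmul_eq_mul, lintegral_const_mul _ ((hq k).pow_const _)]
      _ ≤ ∫⁻ t in B k, ENNReal.ofReal (δ / N) * ∑ m ∈ Finset.Ico k N,
            (m.descFactorial k : ENNReal) * μ (Prod.mk t ⁻¹' O k) ^ (m - k)
            ∂Measure.pi (fun _ => μ) := setLIntegral_mono' (hBm k) (hpt k hk)
      _ ≤ ∫⁻ t in C k, ENNReal.ofReal (δ / N) * ∑ m ∈ Finset.Ico k N,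
            (m.descFactorial k : ENNReal) * μ (Prod.mk t ⁻¹' O k) ^ (m - k)
            ∂Measure.pi (fun _ => μ) := lintegral_mono_set Set.inter_subset_left
      _ = _ := by
          rw [lintegral_const_mul' _ _ ENNReal.ofReal_ne_top, lintegral_finsetSum _
            (fun m _ => ((hq k).pow_const _).const_mul _)]
          simp only [hI]
          congr 1
          exact Finset.sum_congr rfl fun m _ => lintegral_const_mul _ ((hq k).pow_const _)
  calc Measure.pi (fun _ => μ) (⋃ k, ⋃ σ : Fin k ↪ Fin N, pickEvent (B k) (O k) σ)
      ≤ ∑ k ∈ Finset.range N,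
          Measure.pi (fun _ => μ) (⋃ σ : Fin k ↪ Fin N, pickEvent (B k) (O k) σ) :=
        (measure_mono hsub).trans (measure_biUnion_finset_le _ _)
    _ ≤ ∑ k ∈ Finset.range N, ENNReal.ofReal (δ / N) *
          ∑ m ∈ Finset.Ico k N, (m.descFactorial k : ENNReal) * I m k :=
        Finset.sum_le_sum fun k hk' => hk k (Finset.mem_range.1 hk')
    _ = ENNReal.ofReal (δ / N) * ∑ m ∈ Finset.range N,
          ∑ k ∈ Finset.range (m + 1), (m.descFactorial k : ENNReal) * I m k := by
        rw [← Finset.mul_sum]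
        congr 1
        refine Finset.sum_comm' fun k m => ?_
        simp only [Finset.mem_range, Finset.mem_Ico]
        omega
    _ ≤ ENNReal.ofReal (δ / N) * ∑ m ∈ Finset.range N, 1 := by
        gcongr with m _
        exact sum_descFactorial_mul_lintegral_le_one μ hC hO m (hdisj m)
    _ ≤ ENNReal.ofReal δ := by
        rw [Finset.sum_const, Finset.card_range, nsmul_one, ← ENNReal.ofReal_natCast,
          ← ENNReal.ofReal_mul (by positivity)]
        refine ENNReal.ofReal_le_ofReal ?_
        rcases N.eq_zero_or_pos with rfl | hN
        · simpa using hδ.le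
        · exact (div_mul_cancel₀ δ (by positivity : (N : ℝ) ≠ 0)).le

end Core

/-! ### Measurability of picking -/

section Measurability

theorem map_eval_eq_ofFn {α Z : Type*} (S : List (α → Z)) (ω : α) :
    S.map (· ω) = List.ofFn fun i : Fin S.length => S.get i ω := by
  conv_lhs => rw [← List.ofFn_get S, List.map_ofFn]
  rfl

variable {α X : Type*} [MeasurableSpace α] [MeasurableSpace X]

theorem measurable_get {S : List (α → X)} (hS : ∀ s ∈ S, Measurable s) :
    Measurable fun ω => fun i : Fin S.length => S.get i ω :=
  measurable_pi_iff.2 fun i => hS _ (List.get_mem S i)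

/-- The points are given as measurable functions of a common parameter `ω`; this makes the induction
on the list of points immediate. -/
theorem measurableSet_picks {le : α → List X → X → X → Prop} {viol : α → List X → X → Prop}
    (hle : ∀ S : List (α → X), (∀ s ∈ S, Measurable s) → ∀ a b : α → X, Measurable a →
      Measurable b → MeasurableSet {ω | le ω (S.map (· ω)) (a ω) (b ω)})
    (hviol : ∀ S : List (α → X), (∀ s ∈ S, Measurable s) → ∀ a : α → X, Measurable a →
      MeasurableSet {ω | viol ω (S.map (· ω)) (a ω)})
    (S T : List (α → X)) (hS : ∀ s ∈ S, Measurable s) (hT : ∀ t ∈ T, Measurable t) :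
    MeasurableSet {ω | Picks (le ω) (viol ω) (S.map (· ω)) (T.map (· ω))} := by
  induction T generalizing S with
  | nil => exact MeasurableSet.univ
  | cons t T ih =>
    have ht : Measurable t := hT t (by simp)
    have hT' : ∀ t ∈ T, Measurable t := fun t ht => hT t (by simp [ht])
    have hS' : ∀ s ∈ S ++ [t], Measurable s := by
      simpa [or_imp, forall_and] using ⟨hS, ht⟩
    have h : {ω | Picks (le ω) (viol ω) (S.map (· ω)) ((t :: T).map (· ω))} =
        {ω | viol ω (S.map (· ω)) (t ω)} ∩
          ((⋂ i : Fin T.length, {ω | le ω (S.map (· ω)) (T.get i ω) (t ω)}) ∩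
            {ω | Picks (le ω) (viol ω) ((S ++ [t]).map (· ω)) (T.map (· ω))}) := by
      ext ω
      simp [Picks, List.forall_mem_iff_get]
    rw [h]
    exact (hviol S hS t ht).inter ((MeasurableSet.iInter fun i =>
      hle S hS _ _ (hT' _ (List.get_mem T i)) ht).inter (ih _ hS' hT'))

theorem measurableSet_unpicked {le : α → List X → X → X → Prop} {viol : α → List X → X → Prop}
    (hle : ∀ S : List (α → X), (∀ s ∈ S, Measurable s) → ∀ a b : α → X, Measurable a →
      Measurable b → MeasurableSet {ω | le ω (S.map (· ω)) (a ω) (b ω)})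
    (hviol : ∀ S : List (α → X), (∀ s ∈ S, Measurable s) → ∀ a : α → X, Measurable a →
      MeasurableSet {ω | viol ω (S.map (· ω)) (a ω)})
    (S T : List (α → X)) (hS : ∀ s ∈ S, Measurable s) (hT : ∀ t ∈ T, Measurable t)
    (x : α → X) (hx : Measurable x) :
    MeasurableSet {ω | Unpicked (le ω) (viol ω) (S.map (· ω)) (T.map (· ω)) (x ω)} := by
  induction T generalizing S with
  | nil => exact (hviol S hS x hx).compl
  | cons t T ih =>
    have ht : Measurable t := hT t (by simp)
    have hT' : ∀ t ∈ T, Measurable t := fun t ht => hT t (by simp [ht])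
    have hS' : ∀ s ∈ S ++ [t], Measurable s := by
      simpa [or_imp, forall_and] using ⟨hS, ht⟩
    have h : {ω | Unpicked (le ω) (viol ω) (S.map (· ω)) ((t :: T).map (· ω)) (x ω)} =
        {ω | le ω (S.map (· ω)) (x ω) (t ω)} ∩
            {ω | Unpicked (le ω) (viol ω) ((S ++ [t]).map (· ω)) (T.map (· ω)) (x ω)} := by
      ext ω
      simp [Unpicked]
    rw [h]
    exact (hle S hS _ _ hx ht).inter (ih _ hS' hT')

end Measurability

/-! ### Breaking ties between copies of a point by random marks -/

section Marks

open MeasureTheory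

/-- Marks are drawn uniformly from the unit interval. -/
abbrev Mark : Type := unitInterval

variable {Z Y : Type*}

/-- The order on marked points `(z, u)`: points are compared by `r`, and copies of the same point
by their marks. -/
def markedLE (r : List Z → Z → Z → Prop) (S : List (Z × Mark)) (a b : Z × Mark) : Prop :=
  r (S.map Prod.fst) a.1 b.1 ∧ (a.1 = b.1 → a.2 ≤ b.2)

/-- Violation for marked points: the marks play no role. -/
def markedViol (v : List Z → Z → Prop) (S : List (Z × Mark)) (a : Z × Mark) : Prop :=
  v (S.map Prod.fst) a.1

theorem markedLE_total {r : List Z → Z → Z → Prop} (htot : ∀ S a b, r S a b ∨ r S b a)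
    (S : List (Z × Mark)) (a b : Z × Mark) : markedLE r S a b ∨ markedLE r S b a := by
  have h := htot (S.map Prod.fst)
  by_cases hab : a.1 = b.1
  · rcases le_total a.2 b.2 with h2 | h2
    · exact Or.inl ⟨hab ▸ (h a.1 a.1).elim id id, fun _ => h2⟩
    · exact Or.inr ⟨hab ▸ (h a.1 a.1).elim id id, fun _ => h2⟩
  · rcases h a.1 b.1 with h2 | h2
    · exact Or.inl ⟨h2, fun h => absurd h hab⟩
    · exact Or.inr ⟨h2, fun h => absurd h.symm hab⟩

theorem markedLE_trans {r : List Z → Z → Z → Prop}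
    (hanti : ∀ S a b, r S a b → r S b a → a = b)
    (htrans : ∀ S a b c, r S a b → r S b c → r S a c)
    (S : List (Z × Mark)) (a b c : Z × Mark) (hab : markedLE r S a b) (hbc : markedLE r S b c) :
    markedLE r S a c := by
  refine ⟨htrans _ _ _ _ hab.1 hbc.1, fun h => ?_⟩
  have h1 : a.1 = b.1 := hanti _ _ _ hab.1 (h ▸ hbc.1)
  exact (hab.2 h1).trans (hbc.2 (h1.symm.trans h))

theorem markedLE_antisymm {r : List Z → Z → Z → Prop}
    (hanti : ∀ S a b, r S a b → r S b a → a = b)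
    (S : List (Z × Mark)) (a b : Z × Mark) (hab : markedLE r S a b) (hba : markedLE r S b a) :
    a = b := by
  have h1 := hanti _ _ _ hab.1 hba.1
  exact Prod.ext h1 (le_antisymm (hab.2 h1) (hba.2 h1.symm))

/-- The lists of marked points that get picked, as a subset of `(Z × Mark)ᵏ`. -/
def pickedSet (r : List Z → Z → Z → Prop) (v : List Z → Z → Prop) (k : ℕ) :
    Set (Fin k → Z × Mark) :=
  {t | Picks (markedLE r) (markedViol v) [] (List.ofFn t)}

/-- The pairs of a list of picked marked points and a marked point that does not interfere with
the picking of this list. -/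
def unpickedSet (r : List Z → Z → Z → Prop) (v : List Z → Z → Prop) (k : ℕ) :
    Set ((Fin k → Z × Mark) × (Z × Mark)) :=
  {p | Unpicked (markedLE r) (markedViol v) [] (List.ofFn p.1) p.2}

/-- The values of `x` at the indices in the range of `σ` come first, the remaining values next. -/
theorem exists_perm_ofFn {m k : ℕ} {X : Type*} (x : Fin m → X) (σ : Fin k ↪ Fin m) :
    ∃ R : List (Fin m), (∀ j ∈ R, j ∉ Set.range σ) ∧
      (List.ofFn (x ∘ σ) ++ R.map x).Perm (List.ofFn x) := by
  classical
  refine ⟨(List.finRange m).filter fun j => j ∉ Set.range σ, by simp, ?_⟩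
  have h1 : List.ofFn (x ∘ σ) = (List.ofFn σ).map x := (List.map_ofFn ..).symm
  have h2 : List.ofFn x = (List.finRange m).map x := by rw [List.ofFn_eq_map]
  rw [h1, h2, ← List.map_append]
  refine List.Perm.map x ((List.perm_ext_iff_of_nodup ?_ (List.nodup_finRange m)).2 ?_)
  · refine List.Nodup.append (List.nodup_ofFn.2 σ.injective) ((List.nodup_finRange m).filter _) ?_
    intro j hj hj'
    simp at hj hj'
    obtain ⟨i, rfl⟩ := hj
    exact hj' i rfl
  · intro j
    simp only [List.mem_append, List.mem_ofFn, List.mem_filter, List.mem_finRange, true_and,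
      decide_eq_true_eq, iff_true]
    exact em _

/-- If the marked points are pairwise distinct, at most one list of indices can be picked. -/
theorem pickEvent_index_unique {r : List Z → Z → Z → Prop} {v : List Z → Z → Prop}
    (hanti : ∀ S a b, r S a b → r S b a → a = b) (htot : ∀ S a b, r S a b ∨ r S b a)
    {m : ℕ} {x : Fin m → Z × Mark} (hx : Function.Injective x) {a b : Σ k, Fin k ↪ Fin m}
    (ha : x ∈ pickEvent (pickedSet r v a.1) (unpickedSet r v a.1) a.2)
    (hb : x ∈ pickEvent (pickedSet r v b.1) (unpickedSet r v b.1) b.2) : a = b := by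
  obtain ⟨k, σ⟩ := a
  obtain ⟨l, τ⟩ := b
  obtain ⟨R, hR, hRp⟩ := exists_perm_ofFn x σ
  obtain ⟨R', hR', hRp'⟩ := exists_perm_ofFn x τ
  have h : List.ofFn (x ∘ σ) = List.ofFn (x ∘ τ) := by
    refine Picks.unique (markedLE_antisymm hanti)
      (fun S a => (markedLE_total htot S a a).elim id id) (hRp.trans hRp'.symm) ha.1 ?_ hb.1 ?_
    · intro y hy
      obtain ⟨j, hj, rfl⟩ := List.mem_map.1 hy
      exact ha.2 j (hR j hj)
    · intro y hy
      obtain ⟨j, hj, rfl⟩ := List.mem_map.1 hy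
      exact hb.2 j (hR' j hj)
  have hkl : k = l := by simpa using congrArg List.length h
  subst hkl
  have hστ : σ = τ := by
    ext1 i
    exact hx (congrFun (List.ofFn_injective h) i)
  rw [hστ]

variable [MeasurableSpace Z] [MeasurableSpace Y]

/-- Marked points are almost surely pairwise distinct, even if `Pz` has atoms. -/
theorem measure_not_injective (Pz : Measure Z) [IsProbabilityMeasure Pz] (m : ℕ) :
    Measure.pi (fun _ : Fin m => Pz.prod (volume : Measure Mark))
      {x | ¬ Function.Injective x} = 0 := by
  have hpair : ∀ i j : Fin m, i ≠ j →
      Measure.pi (fun _ : Fin m => Pz.prod (volume : Measure Mark))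
        {x | (x i).2 = (x j).2} = 0 := by
    intro i j hij
    obtain ⟨m, rfl⟩ : ∃ m', m = m' + 1 := ⟨m - 1, by have := i.pos; omega⟩
    obtain ⟨j, rfl⟩ := Fin.exists_succAbove_eq hij.symm
    have hmp := measurePreserving_piFinSuccAbove
      (fun _ : Fin (m + 1) => Pz.prod (volume : Measure Mark)) i
    have hA : MeasurableSet {p : (Z × Mark) × (Fin m → Z × Mark) | p.1.2 = (p.2 j).2} :=
      measurableSet_eq_fun (by fun_prop) (by fun_prop)
    have := hmp.measure_preimage hA.nullMeasurableSet
    refine this.trans ?_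
    rw [Measure.prod_apply_symm hA, lintegral_eq_zero_iff (measurable_measure_prodMk_right hA)]
    refine Filter.Eventually.of_forall fun q => ?_
    have : (fun p => (p, q)) ⁻¹' {p : (Z × Mark) × (Fin m → Z × Mark) | p.1.2 = (p.2 j).2} =
        Set.univ ×ˢ {(q j).2} := by
      ext p
      simp
    simp only [this, Measure.prod_prod]
    simp
  refine measure_mono_null (t := ⋃ (i) (j) (_ : i ≠ j), {x : Fin m → Z × Mark | (x i).2 = (x j).2})
    ?_ ?_
  · intro x hx
    simp only [Set.mem_ofPred_eq, Function.Injective, not_forall] at hx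
    obtain ⟨i, j, h, hij⟩ := hx
    simp only [Set.mem_iUnion]
    exact ⟨i, j, hij, congrArg Prod.snd h⟩
  · simp only [measure_iUnion_null_iff]
    exact hpair

/-- The event that, for the initial data `y` and the marked dataset `x`, the probability that a
fresh marked point interferes with the picked list is above the threshold. -/
def badSet (r : Y → List Z → Z → Z → Prop) (v : Y → List Z → Z → Prop) (Pz : Measure Z) (δ : ℝ)
    (n : ℕ) : Set (Y × (Fin n → Z × Mark)) :=
  {p | p.2 ∈ ⋃ k, ⋃ σ : Fin k ↪ Fin n,
    pickEvent (pickedSet (r p.1) (v p.1) k ∩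
      {t | epsBar k δ n < 1 - (Pz.prod (volume : Measure Mark)).real
        (Prod.mk t ⁻¹' unpickedSet (r p.1) (v p.1) k)}) (unpickedSet (r p.1) (v p.1) k) σ}

variable {r : Y → List Z → Z → Z → Prop} {v : Y → List Z → Z → Prop}

/-- The standing assumptions on the orders `r y S` and the violation predicates `v y S`, which
depend on the initial data `y` and the list `S` of points picked so far. -/
structure IsPickingRule (r : Y → List Z → Z → Z → Prop) (v : Y → List Z → Z → Prop) : Prop where
  antisymm : ∀ y S a b, r y S a b → r y S b a → a = b
  total : ∀ y S a b, r y S a b ∨ r y S b a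
  trans : ∀ y S a b c, r y S a b → r y S b c → r y S a c
  /-- The points that dominate a violating point violate the property, too. -/
  viol_mono : ∀ y S a b, r y S a b → v y S a → v y S b
  measurableSet_le : ∀ m, MeasurableSet {p : (Y × (Fin m → Z)) × (Z × Z) |
    r p.1.1 (List.ofFn p.1.2) p.2.1 p.2.2}
  measurableSet_viol : ∀ m, MeasurableSet {p : (Y × (Fin m → Z)) × Z |
    v p.1.1 (List.ofFn p.1.2) p.2}

theorem IsPickingRule.refl (hrv : IsPickingRule r v) (y : Y) (S : List Z) (a : Z) : r y S a a :=
  (hrv.total y S a a).elim id id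

theorem measurableSet_markedLE (hrv : IsPickingRule r v)
    {α : Type*} [MeasurableSpace α] {y : α → Y} (hy : Measurable y)
    (S : List (α → Z × Mark)) (hS : ∀ s ∈ S, Measurable s) (a b : α → Z × Mark) (ha : Measurable a)
    (hb : Measurable b) :
    MeasurableSet {ω | markedLE (r (y ω)) (S.map (· ω)) (a ω) (b ω)} := by
  set F : List (α → Z) := S.map fun s ω => (s ω).1 with hF
  have hFm : ∀ s ∈ F, Measurable s := by
    intro s hs
    obtain ⟨s', hs', rfl⟩ := List.mem_map.1 hs
    exact measurable_fst.comp (hS s' hs')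
  have hmap : ∀ ω, (S.map (· ω)).map Prod.fst = F.map (· ω) := by
    intro ω
    simp [hF, Function.comp_def]
  have hmeas : ∀ a b : α → Z × Mark, Measurable a → Measurable b →
      MeasurableSet {ω | r (y ω) (F.map (· ω)) (a ω).1 (b ω).1} := by
    intro a b ha hb
    simp only [map_eval_eq_ofFn F]
    exact ((hy.prodMk (measurable_get hFm)).prodMk
      ((measurable_fst.comp ha).prodMk (measurable_fst.comp hb))) (hrv.measurableSet_le F.length)
  -- Equality of points is not assumed to be measurable; given `r a b`, it amounts to `r b a`.
  have heq : {ω | markedLE (r (y ω)) (S.map (· ω)) (a ω) (b ω)} =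
      {ω | r (y ω) (F.map (· ω)) (a ω).1 (b ω).1} ∩
        ({ω | r (y ω) (F.map (· ω)) (b ω).1 (a ω).1}ᶜ ∪ {ω | (a ω).2 ≤ (b ω).2}) := by
    ext ω
    simp only [markedLE, hmap, Set.mem_ofPred_eq, Set.mem_inter_iff, Set.mem_union,
      Set.mem_compl_iff]
    refine and_congr_right fun h => ?_
    rw [imp_iff_not_or]
    refine or_congr_left (not_congr ⟨fun h' => h' ▸ hrv.refl _ _ _,
      fun h' => hrv.antisymm _ _ _ _ h h'⟩)
  rw [heq]
  exact (hmeas a b ha hb).inter ((hmeas b a hb ha).compl.union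
    (measurableSet_le (measurable_snd.comp ha) (measurable_snd.comp hb)))

theorem measurableSet_markedViol (hrv : IsPickingRule r v)
    {α : Type*} [MeasurableSpace α] {y : α → Y} (hy : Measurable y)
    (S : List (α → Z × Mark)) (hS : ∀ s ∈ S, Measurable s) (a : α → Z × Mark) (ha : Measurable a) :
    MeasurableSet {ω | markedViol (v (y ω)) (S.map (· ω)) (a ω)} := by
  set F : List (α → Z) := S.map fun s ω => (s ω).1 with hF
  have hFm : ∀ s ∈ F, Measurable s := by
    intro s hs
    obtain ⟨s', hs', rfl⟩ := List.mem_map.1 hs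
    exact measurable_fst.comp (hS s' hs')
  have hmap : ∀ ω, (S.map (· ω)).map Prod.fst = F.map (· ω) := by
    intro ω
    simp [hF, Function.comp_def]
  simp only [markedViol, hmap, map_eval_eq_ofFn F]
  exact ((hy.prodMk (measurable_get hFm)).prodMk (measurable_fst.comp ha))
    (hrv.measurableSet_viol F.length)

theorem measurableSet_pickedSet (hrv : IsPickingRule r v) (k : ℕ) :
    MeasurableSet {p : Y × (Fin k → Z × Mark) | p.2 ∈ pickedSet (r p.1) (v p.1) k} := by
  have h := measurableSet_picks (α := Y × (Fin k → Z × Mark)) (X := Z × Mark)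
    (le := fun p => markedLE (r p.1)) (viol := fun p => markedViol (v p.1))
    (fun S hS a b ha hb => measurableSet_markedLE hrv measurable_fst S hS a b ha hb)
    (fun S hS a ha => measurableSet_markedViol hrv measurable_fst S hS a ha)
    [] (List.ofFn fun i p => p.2 i) (by simp)
    (by
      intro t ht
      obtain ⟨i, rfl⟩ := (List.mem_ofFn' _ _).1 ht
      exact (measurable_pi_apply i).comp measurable_snd)
  simp only [List.map_ofFn, List.map_nil] at h
  exact h

theorem measurableSet_unpickedSet (hrv : IsPickingRule r v) (k : ℕ) :
    MeasurableSet {p : (Y × (Fin k → Z × Mark)) × (Z × Mark) |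
      (p.1.2, p.2) ∈ unpickedSet (r p.1.1) (v p.1.1) k} := by
  have h := measurableSet_unpicked (α := (Y × (Fin k → Z × Mark)) × (Z × Mark)) (X := Z × Mark)
    (le := fun p => markedLE (r p.1.1)) (viol := fun p => markedViol (v p.1.1))
    (fun S hS a b ha hb => measurableSet_markedLE hrv
      (measurable_fst.comp measurable_fst) S hS a b ha hb)
    (fun S hS a ha => measurableSet_markedViol hrv (measurable_fst.comp measurable_fst) S hS a ha)
    [] (List.ofFn fun i p => p.1.2 i) (by simp)
    (by
      intro t ht
      obtain ⟨i, rfl⟩ := (List.mem_ofFn' _ _).1 ht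
      exact (measurable_pi_apply i).comp (measurable_snd.comp measurable_fst))
    Prod.snd measurable_snd
  simp only [List.map_ofFn, List.map_nil] at h
  exact h

theorem measurableSet_badSet (hrv : IsPickingRule r v) (Pz : Measure Z)
    [IsProbabilityMeasure Pz] (δ : ℝ) (n : ℕ) :
    MeasurableSet (badSet r v Pz δ n) := by
  have hC := measurableSet_pickedSet hrv
  have hO := measurableSet_unpickedSet hrv
  have h : badSet r v Pz δ n = ⋃ k, ⋃ σ : Fin k ↪ Fin n,
      ((fun p : Y × (Fin n → Z × Mark) => (p.1, p.2 ∘ σ)) ⁻¹'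
        ({p | p.2 ∈ pickedSet (r p.1) (v p.1) k} ∩
          {p | epsBar k δ n < 1 - (Pz.prod (volume : Measure Mark)).real (Prod.mk p ⁻¹'
            {p : (Y × (Fin k → Z × Mark)) × (Z × Mark) |
              (p.1.2, p.2) ∈ unpickedSet (r p.1.1) (v p.1.1) k})}) ∩
      ⋂ (j) (_ : j ∉ Set.range σ), (fun p : Y × (Fin n → Z × Mark) => ((p.1, p.2 ∘ σ), p.2 j)) ⁻¹'
        {p | (p.1.2, p.2) ∈ unpickedSet (r p.1.1) (v p.1.1) k}) := by
    ext p
    simp only [badSet, pickEvent, Set.mem_ofPred_eq, Set.mem_iUnion, Set.mem_inter_iff,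
      Set.mem_preimage, Set.mem_iInter]
    rfl
  rw [h]
  refine MeasurableSet.iUnion fun k => MeasurableSet.iUnion fun σ => ?_
  have hσ : Measurable fun p : Y × (Fin n → Z × Mark) => (p.1, p.2 ∘ σ) :=
    measurable_fst.prodMk (measurable_pi_iff.2 fun i =>
      (measurable_pi_apply (σ i)).comp measurable_snd)
  refine (hσ ((hC k).inter (measurableSet_lt measurable_const (measurable_const.sub
    (measurable_measure_prodMk_left (hO k)).ennreal_toReal)))).inter ?_
  exact MeasurableSet.iInter fun j => MeasurableSet.iInter fun _ =>
    (hσ.prodMk ((measurable_pi_apply j).comp measurable_snd)) (hO k)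

/-- The bad event has probability at most `δ`, as each of its sections at fixed initial data has. -/
theorem measure_badSet_le (hrv : IsPickingRule r v) (ν : Measure Y)
    [IsProbabilityMeasure ν] (Pz : Measure Z) [IsProbabilityMeasure Pz] {δ : ℝ} (hδ : 0 < δ)
    (hδ1 : δ < 1) (n : ℕ) :
    (ν.prod (Measure.pi fun _ => Pz.prod (volume : Measure Mark))) (badSet r v Pz δ n) ≤
      ENNReal.ofReal δ := by
  rw [Measure.prod_apply (measurableSet_badSet hrv Pz δ n)]
  suffices h : ∀ y, Measure.pi (fun _ => Pz.prod (volume : Measure Mark))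
      (Prod.mk y ⁻¹' badSet r v Pz δ n) ≤ ENNReal.ofReal δ from
    (lintegral_mono h).trans (by simp)
  intro y
  refine measure_iUnion_pickEvent_le (Pz.prod (volume : Measure Mark))
    (fun k => measurable_prodMk_left (measurableSet_pickedSet hrv k))
    (fun k => ((measurable_const.prodMk measurable_fst).prodMk measurable_snd :
      Measurable fun p : (Fin k → Z × Mark) × (Z × Mark) => ((y, p.1), p.2))
      (measurableSet_unpickedSet hrv k)) (fun m a b hab => ?_) hδ hδ1
  refine measure_mono_null (fun x hx => ?_) (measure_not_injective Pz m)
  exact fun hinj => hab (pickEvent_index_unique (hrv.antisymm y) (hrv.total y) hinj hx.1 hx.2)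

/-- Every dataset splits into picked and unpicked points; if the probability of violation that the
picked list leaves is too large, then the dataset belongs to the bad event, whatever the initial
data and whatever the marks. -/
theorem exists_picks_mem_badSet (hrv : IsPickingRule r v) (Pz : Measure Z)
    [IsProbabilityMeasure Pz] (δ : ℝ) {n : ℕ} (y : Y) (x : Fin n → Z × Mark) :
    ∃ T R, (T ++ R).Perm (List.ofFn fun i => (x i).1) ∧ Picks (r y) (v y) [] T ∧
      (∀ z ∈ R, Unpicked (r y) (v y) [] T z) ∧
      (epsBar T.length δ n < Pz.real {z | v y T z} → (y, x) ∈ badSet r v Pz δ n) := by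
  obtain ⟨T, R, hp, hT, hR⟩ := exists_picks
    (le := fun S i j => markedLE (r y) (S.map x) (x i) (x j))
    (viol := fun S i => markedViol (v y) (S.map x) (x i))
    (fun S i j => markedLE_total (hrv.total y) _ _ _)
    (fun S i j k => markedLE_trans (hrv.antisymm y) (hrv.trans y) _ _ _ _)
    (fun S i j h => hrv.viol_mono y _ _ _ h.1) (List.finRange n) []
  have hTx : Picks (markedLE (r y)) (markedViol (v y)) [] (T.map x) :=
    hT.map x (fun _ _ _ h => h) (fun _ _ => Iff.rfl)
  have hRx : ∀ i ∈ R, Unpicked (markedLE (r y)) (markedViol (v y)) [] (T.map x) (x i) :=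
    fun i hi => (hR i hi).map x (fun _ _ _ h => h) (fun _ _ => Iff.rfl)
  refine ⟨(T.map x).map Prod.fst, (R.map x).map Prod.fst, ?_,
    hTx.map Prod.fst (fun _ _ _ h => h.1) (fun _ _ => Iff.rfl), ?_, ?_⟩
  · have h := (hp.map x).map Prod.fst
    rw [List.map_append, List.map_append] at h
    rwa [List.ofFn_eq_map, show (fun i => (x i).1) = Prod.fst ∘ x from rfl, ← List.map_map]
  · intro z hz
    simp only [List.mem_map] at hz
    obtain ⟨_, ⟨i, hi, rfl⟩, rfl⟩ := hz
    exact (hRx i hi).map Prod.fst (fun _ _ _ h => h.1) (fun _ _ => Iff.rfl)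
  · intro hε
    have hnd : (T ++ R).Nodup := hp.nodup_iff.2 (List.nodup_finRange n)
    let σ : Fin T.length ↪ Fin n := ⟨T.get, List.nodup_iff_injective_get.1 hnd.of_append_left⟩
    have hσ : List.ofFn (x ∘ σ) = T.map x := by
      conv_rhs => rw [← List.ofFn_get T, List.map_ofFn]
      rfl
    have hO : MeasurableSet (Prod.mk (x ∘ σ) ⁻¹' unpickedSet (r y) (v y) T.length) :=
      measurable_prodMk_left (x := (y, x ∘ σ)) (measurableSet_unpickedSet hrv T.length)
    have hrisk : Pz.real {z | v y ((T.map x).map Prod.fst) z} ≤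
        1 - (Pz.prod (volume : Measure Mark)).real
          (Prod.mk (x ∘ σ) ⁻¹' unpickedSet (r y) (v y) T.length) := by
      rw [← probReal_compl_eq_one_sub hO]
      have h : Pz.real {z | v y ((T.map x).map Prod.fst) z} =
          (Pz.prod (volume : Measure Mark)).real
            ({z | v y ((T.map x).map Prod.fst) z} ×ˢ Set.univ) := by
        rw [measureReal_prod_prod]
        simp
      rw [h]
      refine measureReal_mono fun p hp hp' => ?_
      have hnot := Unpicked.not_viol (show Unpicked _ _ _ _ _ from hp')
      rw [hσ] at hnot
      exact hnot hp.1
    simp only [List.length_map] at hε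
    refine Set.mem_iUnion.2 ⟨T.length, Set.mem_iUnion.2 ⟨σ, ⟨?_, hε.trans_le hrisk⟩, ?_⟩⟩
    · change Picks _ _ [] (List.ofFn (x ∘ σ))
      rwa [hσ]
    · intro j hj
      change Unpicked _ _ [] (List.ofFn (x ∘ σ)) (x j)
      rw [hσ]
      refine hRx j ((List.mem_append.1 (hp.symm.subset (List.mem_finRange j))).resolve_left ?_)
      exact fun hjT => hj (List.mem_iff_get.1 hjT)

end Marks

/-! ### Marking an i.i.d. sample -/

section Data

open MeasureTheory

variable {Z : Type*} [MeasurableSpace Z]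

/-- Independent uniform marks may be attached to the last `n` points of an i.i.d. sample: the marked
points are i.i.d. and independent of the first points of the sample. -/
theorem measurePreserving_mark (Pz : Measure Z) [IsProbabilityMeasure Pz] (l n : ℕ) :
    MeasurePreserving
      (fun p : (Fin (l + n) → Z) × (Fin n → Mark) =>
        (fun i => p.1 (Fin.castAdd n i), fun j => (p.1 (Fin.natAdd l j), p.2 j)))
      ((Measure.pi fun _ => Pz).prod (Measure.pi fun _ => volume))
      ((Measure.pi fun _ => Pz).prod (Measure.pi fun _ => Pz.prod volume)) := by
  have h1 := (measurePreserving_pi_comp_sum Pz (finSumFinEquiv (m := l) (n := n))).prod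
    (MeasurePreserving.id (Measure.pi fun _ : Fin n => (volume : Measure Mark)))
  have h2 := measurePreserving_prodAssoc (Measure.pi fun _ : Fin l => Pz)
    (Measure.pi fun _ : Fin n => Pz) (Measure.pi fun _ : Fin n => (volume : Measure Mark))
  have h3 := (MeasurePreserving.id (Measure.pi fun _ : Fin l => Pz)).prod
    (measurePreserving_arrowProdEquivProdArrow Z Mark (Fin n) (fun _ => Pz)
      (fun _ => volume)).symm
  exact h3.comp (h2.comp h1)

/-- Transfer of the bound from marked to unmarked datasets. -/
theorem measure_le_of_forall_mem_badSet {l : ℕ} {r : (Fin l → Z) → List Z → Z → Z → Prop}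
    {v : (Fin l → Z) → List Z → Z → Prop} (hrv : IsPickingRule r v) (Pz : Measure Z)
    [IsProbabilityMeasure Pz] {δ : ℝ} (hδ : 0 < δ) (hδ1 : δ < 1) {n : ℕ}
    {S : Set (Fin (l + n) → Z)}
    (hS : ∀ x ∈ S, ∀ u : Fin n → Mark,
      ((fun i => x (Fin.castAdd n i), fun j => (x (Fin.natAdd l j), u j)) :
        (Fin l → Z) × (Fin n → Z × Mark)) ∈ badSet r v Pz δ n) :
    Measure.pi (fun _ => Pz) S ≤ ENNReal.ofReal δ := by
  -- `S` need not be measurable, but `Measure.prod_prod` holds for arbitrary sets.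
  calc Measure.pi (fun _ => Pz) S
      = ((Measure.pi fun _ => Pz).prod (Measure.pi fun _ : Fin n => (volume : Measure Mark)))
          (S ×ˢ Set.univ) := by rw [Measure.prod_prod, measure_univ, mul_one]
    _ ≤ ((Measure.pi fun _ => Pz).prod (Measure.pi fun _ : Fin n => (volume : Measure Mark)))
          ((fun p : (Fin (l + n) → Z) × (Fin n → Mark) =>
            ((fun i => p.1 (Fin.castAdd n i), fun j => (p.1 (Fin.natAdd l j), p.2 j)) :
              (Fin l → Z) × (Fin n → Z × Mark))) ⁻¹' badSet r v Pz δ n) :=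
        measure_mono fun p hp => hS p.1 hp.1 p.2
    _ = _ := (measurePreserving_mark Pz l n).measure_preimage
        (measurableSet_badSet hrv Pz δ n).nullMeasurableSet
    _ ≤ ENNReal.ofReal δ := measure_badSet_le hrv _ Pz hδ hδ1 n

end Data

/-! ### Application to optimal control -/

section Control

variable {nx nu nw nθ H : ℕ}

open Classical in
/-- The parameter held when the training list is `T`: the initial one as long as nothing has been
picked, the output of the synthesis algorithm afterwards. -/
noncomputable def heldParameter {Z Θ : Type*} (L : List Z → Θ) (θ₀ : Θ) (T : List Z) : Θ :=
  if T = [] then θ₀ else L T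

/-- The cost order of the control problem, with ties broken by `tie`, and the violation of the cost
threshold `Jbar`.  Measurability in the picked list is checked separately at the empty list, where
the held parameter comes from the initial data. -/
theorem isPickingRule_control
    {f : Fin H → (Fin nx → ℝ) → (Fin nu → ℝ) → (Fin nw → ℝ) → (Fin nx → ℝ)}
    {ℓ : Fin (H + 1) → (Fin nx → ℝ) → (Fin nu → ℝ) → ℝ}
    {π : (Fin nθ → ℝ) → Policy nx nu H} {Jbar : ℝ}
    {tie : List (Uncertainty nx nw H) → Uncertainty nx nw H → Uncertainty nx nw H → Prop}
    (htie : ∀ T, IsLinearOrder (Uncertainty nx nw H) (tie T))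
    {L : List (Uncertainty nx nw H) → (Fin nθ → ℝ)} {Ni : ℕ}
    {init : List (Uncertainty nx nw H) → (Fin nθ → ℝ)}
    (htie_meas : ∀ m : ℕ, MeasurableSet
      {p : (Fin m → Uncertainty nx nw H) × (Uncertainty nx nw H × Uncertainty nx nw H) |
        tie (List.ofFn p.1) p.2.1 p.2.2})
    (hL_meas : ∀ m : ℕ, Measurable
      fun p : (Fin m → Uncertainty nx nw H) × Uncertainty nx nw H =>
        cost f ℓ (π (L (List.ofFn p.1))) p.2)
    (hinit_meas : Measurable
      fun p : (Fin Ni → Uncertainty nx nw H) × Uncertainty nx nw H =>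
        cost f ℓ (π (init (List.ofFn p.1))) p.2) :
    IsPickingRule
      (fun (y : Fin Ni → Uncertainty nx nw H) S => dissatisfactionLE
        (cost f ℓ (π (heldParameter L (init (List.ofFn y)) S))) (tie S))
      (fun y S z => ¬ cost f ℓ (π (heldParameter L (init (List.ofFn y)) S)) z ≤ Jbar) := by
  have hc : ∀ m : ℕ, Measurable
      fun p : ((Fin Ni → Uncertainty nx nw H) × (Fin m → Uncertainty nx nw H)) ×
          Uncertainty nx nw H =>
        cost f ℓ (π (heldParameter L (init (List.ofFn p.1.1)) (List.ofFn p.1.2))) p.2 := by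
    intro m
    cases m with
    | zero =>
      simp only [List.ofFn_zero, heldParameter, if_true]
      exact hinit_meas.comp
        ((measurable_fst.comp measurable_fst).prodMk measurable_snd)
    | succ m =>
      have hne : ∀ t : Fin (m + 1) → Uncertainty nx nw H, List.ofFn t ≠ [] := fun t => by simp
      simp only [heldParameter, hne, if_false]
      exact (hL_meas (m + 1)).comp ((measurable_snd.comp measurable_fst).prodMk measurable_snd)
  refine ⟨?_, ?_, ?_, ?_, ?_, ?_⟩
  · rintro y S a b (hab | ⟨hab, h⟩) (hba | ⟨hba, h'⟩)
    · exact absurd hab hba.not_gt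
    · exact absurd hba hab.ne'
    · exact absurd hab hba.ne'
    · exact (htie S).antisymm a b h h'
  · intro y S a b
    rcases lt_trichotomy (cost f ℓ (π (heldParameter L (init (List.ofFn y)) S)) a)
      (cost f ℓ (π (heldParameter L (init (List.ofFn y)) S)) b) with h | h | h
    · exact Or.inl (Or.inl h)
    · rcases (htie S).total a b with h' | h'
      · exact Or.inl (Or.inr ⟨h, h'⟩)
      · exact Or.inr (Or.inr ⟨h.symm, h'⟩)
    · exact Or.inr (Or.inl h)
  · rintro y S a b c (hab | ⟨hab, h⟩) (hbc | ⟨hbc, h'⟩)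
    · exact Or.inl (hab.trans hbc)
    · exact Or.inl (hbc ▸ hab)
    · exact Or.inl (hab ▸ hbc)
    · exact Or.inr ⟨hab.trans hbc, (htie S).trans a b c h h'⟩
  · rintro y S a b (hab | ⟨hab, -⟩) ha
    · exact fun hb => ha (hab.le.trans hb)
    · exact fun hb => ha (hab.le.trans hb)
  · intro m
    have ha := (hc m).comp ((measurable_fst.prodMk (measurable_fst.comp measurable_snd)) :
      Measurable fun p : ((Fin Ni → Uncertainty nx nw H) × (Fin m → Uncertainty nx nw H)) ×
          (Uncertainty nx nw H × Uncertainty nx nw H) => (p.1, p.2.1))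
    have hb := (hc m).comp ((measurable_fst.prodMk (measurable_snd.comp measurable_snd)) :
      Measurable fun p : ((Fin Ni → Uncertainty nx nw H) × (Fin m → Uncertainty nx nw H)) ×
          (Uncertainty nx nw H × Uncertainty nx nw H) => (p.1, p.2.2))
    have ht := (((measurable_snd.comp measurable_fst).prodMk measurable_snd) :
      Measurable fun p : ((Fin Ni → Uncertainty nx nw H) × (Fin m → Uncertainty nx nw H)) ×
          (Uncertainty nx nw H × Uncertainty nx nw H) => (p.1.2, p.2)) (htie_meas m)
    exact (measurableSet_lt ha hb).union ((measurableSet_eq_fun ha hb).inter ht)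
  · intro m
    exact (measurableSet_le (hc m) measurable_const).compl

end Control

end P2L

theorem corollary2 {nx nu nw nθ H : ℕ}
    (f : Fin H → (Fin nx → ℝ) → (Fin nu → ℝ) → (Fin nw → ℝ) → (Fin nx → ℝ))
    (ℓ : Fin (H + 1) → (Fin nx → ℝ) → (Fin nu → ℝ) → ℝ)
    (π : (Fin nθ → ℝ) → P2L.Policy nx nu H) (Jbar : ℝ)
    -- tie-breaking rule: a total order on the data points for each training list
    (tie : List (P2L.Uncertainty nx nw H) →
      P2L.Uncertainty nx nw H → P2L.Uncertainty nx nw H → Prop)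
    (htie : ∀ T, IsLinearOrder (P2L.Uncertainty nx nw H) (tie T))
    -- synthesis algorithm
    (L : List (P2L.Uncertainty nx nw H) → (Fin nθ → ℝ))
    -- initial parameter, computed from the first `Ni` data points
    (N Ni : ℕ) (hNi : Ni ≤ N)
    (init : List (P2L.Uncertainty nx nw H) → (Fin nθ → ℝ))
    -- measurability
    (htie_meas : ∀ m : ℕ, MeasurableSet
      {p : (Fin m → P2L.Uncertainty nx nw H) ×
          (P2L.Uncertainty nx nw H × P2L.Uncertainty nx nw H) |
        tie (List.ofFn p.1) p.2.1 p.2.2})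
    (hL_meas : ∀ m : ℕ, Measurable
      fun p : (Fin m → P2L.Uncertainty nx nw H) × P2L.Uncertainty nx nw H =>
        P2L.cost f ℓ (π (L (List.ofFn p.1))) p.2)
    (hinit_meas : Measurable
      fun p : (Fin Ni → P2L.Uncertainty nx nw H) × P2L.Uncertainty nx nw H =>
        P2L.cost f ℓ (π (init (List.ofFn p.1))) p.2)
    -- i.i.d. data with distribution `Pz`
    {Ω : Type*} [MeasurableSpace Ω] (P : MeasureTheory.Measure Ω)
    [MeasureTheory.IsProbabilityMeasure P]
    (Pz : MeasureTheory.Measure (P2L.Uncertainty nx nw H))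
    [MeasureTheory.IsProbabilityMeasure Pz]
    (z : Fin N → Ω → P2L.Uncertainty nx nw H)
    (hlaw : ∀ i, ProbabilityTheory.HasLaw (z i) Pz P)
    (hindep : ProbabilityTheory.iIndepFun z P)
    (δ : ℝ) (hδ : δ ∈ Set.Ioo (0 : ℝ) 1) :
    1 - δ ≤ P.real {ω |
      let D := List.ofFn fun i => z i ω
      let out := P2L.controlRun f ℓ π Jbar tie L (init (D.take Ni)) (D.drop Ni)
      Pz.real {z' | Jbar < P2L.cost f ℓ (π out.1) z'} ≤ P2L.epsBar out.2.length δ (N - Ni)} := by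
  obtain ⟨n, rfl⟩ := Nat.exists_eq_add_of_le hNi
  have hrv := P2L.isPickingRule_control (Jbar := Jbar) htie htie_meas hL_meas hinit_meas
  set S : Set (Fin (Ni + n) → P2L.Uncertainty nx nw H) := {x |
    let D := List.ofFn x
    let out := P2L.controlRun f ℓ π Jbar tie L (init (D.take Ni)) (D.drop Ni)
    ¬ Pz.real {z' | Jbar < P2L.cost f ℓ (π out.1) z'} ≤
      P2L.epsBar out.2.length δ (Ni + n - Ni)} with hS
  have hPiS : MeasureTheory.Measure.pi (fun _ => Pz) S ≤ ENNReal.ofReal δ := by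
    refine P2L.measure_le_of_forall_mem_badSet hrv Pz hδ.1 hδ.2 fun x hx u => ?_
    have hlen : (List.ofFn fun i => x (Fin.castAdd n i)).length = Ni := List.length_ofFn
    have htake : (List.ofFn x).take Ni = List.ofFn fun i => x (Fin.castAdd n i) := by
      rw [List.ofFn_add]; exact List.take_left' hlen
    have hdrop : (List.ofFn x).drop Ni = List.ofFn fun j => x (Fin.natAdd Ni j) := by
      rw [List.ofFn_add]; exact List.drop_left' hlen
    obtain ⟨T, R, hp, hT, hR, hbad⟩ := P2L.exists_picks_mem_badSet hrv Pz δ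
      (fun i => x (Fin.castAdd n i)) (fun j => (x (Fin.natAdd Ni j), u j))
    refine hbad ?_
    have hrun := P2L.loop_eq_of_picks (L := L) (φ := fun θ z => P2L.cost f ℓ (π θ) z ≤ Jbar)
      (le := fun T θ => P2L.dissatisfactionLE (P2L.cost f ℓ (π θ)) (tie T))
      (P2L.heldParameter L (init (List.ofFn fun i => x (Fin.castAdd n i))))
      (fun T z => if_neg (by simp)) (hrv.antisymm _) (hrv.total _) (hrv.trans _)
      (S := []) (by simpa using hp) hT hR
    rw [hS, Set.mem_ofPred_eq] at hx
    simp only [htake, hdrop, Nat.add_sub_cancel_left, P2L.controlRun, P2L.run] at hx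
    rw [show P2L.heldParameter L (init (List.ofFn fun i => x (Fin.castAdd n i))) [] =
      init (List.ofFn fun i => x (Fin.castAdd n i)) from if_pos rfl, List.nil_append] at hrun
    rw [hrun] at hx
    simpa only [not_le] using hx
  have hmap : P.map (fun ω i => z i ω) = MeasureTheory.Measure.pi fun _ => Pz := by
    rw [(ProbabilityTheory.iIndepFun_iff_map_fun_eq_pi_map fun i => (hlaw i).aemeasurable).1 hindep]
    simp only [fun i => (hlaw i).map_eq]
  -- `S` is not known to be measurable, but `Measure.le_map_apply` holds for arbitrary sets.
  have hcompl : P.real ((fun ω i => z i ω) ⁻¹' S) ≤ δ := by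
    refine ENNReal.toReal_le_of_le_ofReal hδ.1.le ?_
    refine (MeasureTheory.Measure.le_map_apply
      (aemeasurable_pi_lambda _ fun i => (hlaw i).aemeasurable) S).trans ?_
    rwa [hmap]
  have hunion := MeasureTheory.measureReal_union_le (μ := P)
    ((fun ω i => z i ω) ⁻¹' Sᶜ) ((fun ω i => z i ω) ⁻¹' S)
  rw [Set.preimage_compl, Set.compl_union_self, MeasureTheory.probReal_univ,
    ← Set.preimage_compl] at hunion
  refine (by linarith : 1 - δ ≤ P.real ((fun ω i => z i ω) ⁻¹' Sᶜ)).trans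
    (MeasureTheory.measureReal_mono fun ω hω => ?_)
  exact not_not.1 hω
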